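/- Let $m,n\ge 0$, let $S^n\subset\mathbb{R}^{n+1}$ be the unit sphere, and let $f:\mathbb{R}^m\to S^n$ be a smooth map. Write $\nabla$ for the connection on $f^*TS^n$ induced by the Levi-Civita connection of $S^n$, $Tf_\alpha=\partial_\alpha f$, and $\tau(f)=\sum_\alpha\nabla_\alpha Tf_\alpha$. Call $f$ a *soliton* if $\tau(f)(x)=Tf_x(x/2)$ for all $x\in\mathbb{R}^m$. For $x_0\in\mathbb{R}^m$, $t_0>0$ put $$G_{x_0,t_0}(x)=\frac{e^{-|x-x_0|^2/4t_0}}{(4\pi t_0)^{m/2}},\qquad \mathcal F_{x_0,t_0}(f)=\frac{t_0}{2}\int_{\mathbb{R}^m}|Tf|^2\,G_{x_0,t_0}\,dV,\qquad \lambda(f)=\sup_{x_0\in\mathbb{R}^m,\ t_0>0}\mathcal F_{x_0,t_0}(f)\in[0,\infty].$$ A soliton $f$ is *entropy stable* if it is a local minimizer of the entropy $\lambda$: there are $k\in\mathbb{N}$ and $\varepsilon>0$ such that $\lambda(f)\le\lambda(g)$ for every smooth $g:\mathbb{R}^m\to S^n$ with $|D^jg(x)-D^jf(x)|\le\varepsilon(1+|D^jf(x)|)$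 for all $x\in\mathbb{R}^m$ and $0\le j\le k$. (These neighbourhoods refine the compact-open $C^\infty$ topology, so a soliton that is not entropy stable is not a local minimizer in that topology either.) With $G=G_{0,1}$, let $L^fX=-\sum_\alpha\nabla_\alpha\nabla_\alpha X-\sum_\alpha R(X,Tf_\alpha)Tf_\alpha+\nabla_{x/2}X$ for smooth sections $X$ of $f^*TS^n$, where $R$ is the curvature tensor of $S^n$, $R(X,Y)Z=\langle Y,Z\rangle X-\langle X,Z\rangle Y$, and let $W^{2,2}_f$ be the set of those $X$ with $\int(|X|^2+|\nabla X|^2+|L^fX|^2)\,G\,dV<\infty$. A soliton $f$ is *$\mathcal F$-stable* if for every $X\in W^{2,2}_f$ there are $q\in\mathbb{R}$ and $V\in\mathbb{R}^m$ with $$\int_{\mathbb{R}^m}\langle X,\,L^fX-2q\,\tau(f)-Tf(V)\rangle\,G\,dV-\int_{\mathbb{R}^m}\Big(q^2|\tau(f)|^2+\tfrac12|Tf(V)|^2\Big)G\,dV\ \ge 0 .$$ For $w\in\mathbb{R}^{n+1}$ the *conformal vector field* of $S^n$ determined by $w$ is $W_p=w-\langle w,p\rangle p$, $p\in S^n$.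 **Corollary.** Let $f:\mathbb{R}^m\to S^n$ be a soliton with $\lambda(f)<\infty$. If there is a nonzero conformal vector field $W$ ($w\ne0$) such that $W_{f(x)}$ is perpendicular to the image of $Tf_x$ for every $x\in\mathbb{R}^m$, then $f$ is either constant or unstable, i.e. neither entropy stable nor $\mathcal F$-stable. In particular, this dichotomy holds for every soliton with $\lambda(f)<\infty$ whose image lies in a great sphere $S^n\cap H$, where $H\subsetneq\mathbb{R}^{n+1}$ is a proper linear subspace. -/

import Mathlib

open scoped ContDiff RealInnerProductSpace

noncomputable section

namespace HarmonicSoliton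

/-- `ℝ^k` with its Euclidean structure. -/
abbrev E (k : ℕ) : Type := EuclideanSpace ℝ (Fin k)

/-- The standard basis vector `∂_i` of `ℝ^k`. -/
def basisVec {k : ℕ} (i : Fin k) : E k := EuclideanSpace.single i 1

/-- `f` is a smooth map `ℝ^m → S^n`, where `S^n` is the unit sphere of `ℝ^{n+1}`. The sphere being an
embedded submanifold, smoothness is smoothness as a map into `ℝ^{n+1}`. -/
def IsSphereMap {m n : ℕ} (f : E m → E (n + 1)) : Prop :=
  ContDiff ℝ ∞ f ∧ ∀ x, f x ∈ Metric.sphere (0 : E (n + 1)) 1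

/-- Orthogonal projection of `ℝ^{n+1}` onto the tangent space `T_p S^n`, for a point `p` of `S^n`. -/
def tangentProj {n : ℕ} (p v : E (n + 1)) : E (n + 1) := v - ⟪v, p⟫ • p

/-- The pull-back Levi-Civita connection on `f^* T S^n`: the derivative `∇_v X` at `x` of a section
`X` of `f^* T S^n` (regarded as an `ℝ^{n+1}`-valued function) in the direction `v`. The Levi-Civita
connection of the round sphere is the tangential part of the flat derivative. -/
def covDeriv {m n : ℕ} (f X : E m → E (n + 1)) (v x : E m) : E (n + 1) :=
  tangentProj (f x) (fderiv ℝ X x v)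

/-- The tension field `τ(f) = tr ∇ Tf = ∑_α ∇_α (Tf_α)`. -/
def tension {m n : ℕ} (f : E m → E (n + 1)) (x : E m) : E (n + 1) :=
  ∑ i : Fin m, covDeriv f (fun y => fderiv ℝ f y (basisVec i)) (basisVec i) x

/-- A soliton `f : ℝ^m → S^n` (based at `(0,1)`): a smooth map with `τ(f) = (x/2) ⌟ Tf`. -/
def IsSoliton {m n : ℕ} (f : E m → E (n + 1)) : Prop :=
  IsSphereMap f ∧ ∀ x, tension f x = fderiv ℝ f x ((1 / 2 : ℝ) • x)

/-- `|Tf|²` at `x`. -/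
def energySq {m n : ℕ} (f : E m → E (n + 1)) (x : E m) : ℝ :=
  ∑ i : Fin m, ‖fderiv ℝ f x (basisVec i)‖ ^ 2

/-- The Gaussian weight `G_{x₀,t₀}(x) = (4 π t₀)^{-m/2} exp (-|x - x₀|² / (4 t₀))`. -/
def gaussian {m : ℕ} (x₀ : E m) (t₀ : ℝ) (x : E m) : ℝ :=
  Real.exp (-(‖x - x₀‖ ^ 2 / (4 * t₀))) / (4 * Real.pi * t₀) ^ ((m : ℝ) / 2)

/-- `𝓕_{x₀,t₀}(f) = (t₀/2) ∫ |Tf|² G_{x₀,t₀} dV`, with values in `[0,∞]`. -/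
def calF {m n : ℕ} (x₀ : E m) (t₀ : ℝ) (f : E m → E (n + 1)) : ENNReal :=
  ENNReal.ofReal (t₀ / 2) * ∫⁻ x, ENNReal.ofReal (energySq f x * gaussian x₀ t₀ x)

/-- The entropy `λ(f) = sup_{x₀ ∈ ℝ^m, t₀ > 0} 𝓕_{x₀,t₀}(f)`, with values in `[0,∞]`. -/
def entropy {m n : ℕ} (f : E m → E (n + 1)) : ENNReal :=
  ⨆ (x₀ : E m) (t₀ : ℝ) (_ : 0 < t₀), calF x₀ t₀ f

/-- `g` is `(k, ε)`-close to `f`: on all of `ℝ^m` the derivatives of order `0, …, k` of `g` differ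
from those of `f` by at most `ε (1 + |D^j f|)`. In particular `g` is uniformly close to `f`. On
compact sets this is `C^k`-closeness, so that these neighbourhoods refine the compact-open `C^∞`
topology; if all derivatives of `f` are bounded they generate the neighbourhoods of `f` in the
topology of uniform convergence of all derivatives. -/
def IsClose {m n : ℕ} (k : ℕ) (ε : ℝ) (f g : E m → E (n + 1)) : Prop :=
  ∀ j ≤ k, ∀ x, ‖iteratedFDeriv ℝ j g x - iteratedFDeriv ℝ j f x‖
    ≤ ε * (1 + ‖iteratedFDeriv ℝ j f x‖)

/-- A soliton is entropy stable if it is a local minimizer of the entropy among all smooth maps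
`ℝ^m → S^n`. -/
def IsEntropyStable {m n : ℕ} (f : E m → E (n + 1)) : Prop :=
  IsSoliton f ∧ ∃ k : ℕ, ∃ ε : ℝ, 0 < ε ∧
    ∀ g : E m → E (n + 1), IsSphereMap g → IsClose k ε f g → entropy f ≤ entropy g

/-- `X` is a smooth section of `f^* T S^n`. -/
def IsSection {m n : ℕ} (f X : E m → E (n + 1)) : Prop :=
  ContDiff ℝ ∞ X ∧ ∀ x, ⟪X x, f x⟫ = 0

/-- The curvature tensor `R(X,Y)Z = ⟨Y,Z⟩ X - ⟨X,Z⟩ Y` of the unit sphere. -/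
def sphereCurv {n : ℕ} (X Y Z : E (n + 1)) : E (n + 1) := ⟪Y, Z⟫ • X - ⟪X, Z⟫ • Y

/-- `L^f X = -Δ X - R(X, Tf_α) Tf_α + ∇_{x/2} X`, with `Δ = ∑_α ∇_α ∇_α`. -/
def opL {m n : ℕ} (f X : E m → E (n + 1)) (x : E m) : E (n + 1) :=
  -(∑ i : Fin m, covDeriv f (fun y => covDeriv f X (basisVec i) y) (basisVec i) x)
    - (∑ i : Fin m, sphereCurv (X x) (fderiv ℝ f x (basisVec i)) (fderiv ℝ f x (basisVec i)))
    + covDeriv f X ((1 / 2 : ℝ) • x) x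

/-- The space `W_f^{2,2}` of sections `X` with `∫ (|X|² + |∇X|² + |L^f X|²) G_{0,1} dV < ∞`. -/
def MemW22 {m n : ℕ} (f X : E m → E (n + 1)) : Prop :=
  IsSection f X ∧
    ∫⁻ x, ENNReal.ofReal ((‖X x‖ ^ 2 + (∑ i : Fin m, ‖covDeriv f X (basisVec i) x‖ ^ 2)
      + ‖opL f X x‖ ^ 2) * gaussian 0 1 x) < ⊤

/-- The second variation `𝓕''(q, V, X)` at a soliton `f`, for a variation `X` of `f` and variations
`V`, `q` of the base point `(x₀,t₀) = (0,1)`. -/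
def secondVar {m n : ℕ} (f : E m → E (n + 1)) (q : ℝ) (V : E m) (X : E m → E (n + 1)) : ℝ :=
  (∫ x, ⟪X x, opL f X x - (2 * q) • tension f x - fderiv ℝ f x V⟫ * gaussian 0 1 x)
    - ∫ x, (q ^ 2 * ‖tension f x‖ ^ 2 + 1 / 2 * ‖fderiv ℝ f x V‖ ^ 2) * gaussian 0 1 x

/-- A soliton `f` is `𝓕`-stable if for each `X ∈ W_f^{2,2}` there are `q ∈ ℝ` and a constant vector
field `V` on `ℝ^m` with `𝓕''(q, V, X) ≥ 0`. -/
def IsFStable {m n : ℕ} (f : E m → E (n + 1)) : Prop :=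
  IsSoliton f ∧ ∀ X, MemW22 f X → ∃ (q : ℝ) (V : E m), 0 ≤ secondVar f q V X

/-- The conformal vector field `W_p = w - ⟨w, p⟩ p` on `S^n` given by `w ∈ ℝ^{n+1}`. -/
def conformalField {n : ℕ} (w p : E (n + 1)) : E (n + 1) := w - ⟪w, p⟫ • p

end HarmonicSoliton

end

/-!
Along a soliton whose conformal field is normal, `w` is perpendicular to the image of `Tf`, so
`⟨w, f⟩` is a constant `c`, and differentiating once more gives `⟨w, τ(f)⟩ = c |Tf|²`. Since
`τ(f) = Tf(x/2)` is also perpendicular to `w`, either `c = 0` or `f` is constant. It remains to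
treat a soliton in the great sphere perpendicular to a unit vector `u`.

Tilting `f` to `cos s • f + sin s • u` multiplies every `𝓕_{x₀,t₀}`, hence `λ`, by `cos² s`, which
contradicts entropy stability if `0 < λ(f) < ∞`.

For the second variation one would like to use `X = u`, for which `L^f u = -|Tf|² u`. As `u` need
not be in `W^{2,2}_f`, take `X = φ(ρ ·) u` for a cutoff `φ`. No choice of `q` and `V` can help, as
`u` is perpendicular to `τ(f)` and to the image of `Tf`, so `𝓕`-stability bounds `∫ φ(ρ x)² |Tf|² G`
by an integral involving derivatives of `φ(ρ ·)`, which tends to zero with `ρ`. By Fatou's lemma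
`Tf = 0`.
-/

open MeasureTheory Filter Topology
open scoped Laplacian

namespace HarmonicSoliton

section InnerProductSpace

variable {V W : Type*} [NormedAddCommGroup V] [NormedSpace ℝ V] [NormedAddCommGroup W]
  [InnerProductSpace ℝ W]

lemma fderiv_inner_const_left (w : W) {g : V → W} {x : V} (hg : DifferentiableAt ℝ g x) (v : V) :
    fderiv ℝ (fun y => ⟪w, g y⟫) x v = ⟪w, fderiv ℝ g x v⟫ := by
  rw [fderiv_inner_apply ℝ (differentiableAt_const w) hg]
  simp

lemma inner_fderiv_eq_zero_of_inner_eq_zero {w : W} {g : V → W} (hg : Differentiable ℝ g)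
    (hw : ∀ x, ⟪w, g x⟫ = 0) (x v : V) : ⟪w, fderiv ℝ g x v⟫ = 0 := by
  rw [← fderiv_inner_const_left w (hg x)]
  simp only [hw, fderiv_fun_const, Pi.zero_apply, zero_apply]

lemma inner_eq_inner_of_inner_fderiv_eq_zero {w : W} {g : V → W} (hg : Differentiable ℝ g)
    (hw : ∀ x v, ⟪w, fderiv ℝ g x v⟫ = 0) (x y : V) : ⟪w, g x⟫ = ⟪w, g y⟫ := by
  refine is_const_of_fderiv_eq_zero (𝕜 := ℝ) ((differentiable_const w).inner ℝ hg)
    (fun z => ContinuousLinearMap.ext fun v => ?_) x y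
  rw [fderiv_inner_const_left w (hg z), hw, zero_apply]

end InnerProductSpace

lemma continuous_fderiv_apply_half {V : Type*} [NormedAddCommGroup V] [NormedSpace ℝ V]
    {φ : V → ℝ} (hφ : ContDiff ℝ 1 φ) :
    Continuous fun x => fderiv ℝ φ x ((1 / 2 : ℝ) • x) := by
  have := hφ.continuous_fderiv one_ne_zero
  fun_prop

section Cutoff

variable {V : Type*} [NormedAddCommGroup V] [InnerProductSpace ℝ V] [FiniteDimensional ℝ V]

/-- The drift Laplacian `Δφ - ⟨x/2, ∇φ⟩`, which is symmetric with respect to the Gaussian weight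
`G_{0,1}`. For a constant `u` perpendicular to the image of `f` it is the differential part of
`L^f`: `L^f (φ u) = -(driftLaplacian φ + φ |Tf|²) u`. -/
noncomputable def driftLaplacian (φ : V → ℝ) (x : V) : ℝ := Δ φ x - fderiv ℝ φ x ((1 / 2 : ℝ) • x)

lemma continuous_laplacian {φ : V → ℝ} (hφ : ContDiff ℝ 2 φ) : Continuous (Δ φ) := by
  rw [InnerProductSpace.laplacian_eq_iteratedFDeriv_stdOrthonormalBasis]
  have := hφ.continuous_iteratedFDeriv le_rfl
  fun_prop

lemma continuous_driftLaplacian {φ : V → ℝ} (hφ : ContDiff ℝ 2 φ) :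
    Continuous (driftLaplacian φ) :=
  (continuous_laplacian hφ).sub (continuous_fderiv_apply_half (hφ.of_le one_le_two))

lemma laplacian_comp_const_smul {φ : V → ℝ} (hφ : ContDiff ℝ 2 φ) (ρ : ℝ) (x : V) :
    Δ (fun y => φ (ρ • y)) x = ρ ^ 2 * Δ φ (ρ • x) := by
  simp only [InnerProductSpace.laplacian_eq_iteratedFDeriv_stdOrthonormalBasis,
    iteratedFDeriv_comp_const_smul ρ hφ, smul_apply, smul_eq_mul, Finset.mul_sum]

lemma driftLaplacian_comp_const_smul {φ : V → ℝ} (hφ : ContDiff ℝ 2 φ) (ρ : ℝ) (x : V) :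
    driftLaplacian (fun y => φ (ρ • y)) x
      = ρ ^ 2 * Δ φ (ρ • x) - fderiv ℝ φ (ρ • x) ((1 / 2 : ℝ) • ρ • x) := by
  rw [driftLaplacian, laplacian_comp_const_smul hφ, fderiv_comp_smul, smul_comm (1 / 2 : ℝ) ρ x,
    map_smul _ ρ, smul_apply]

end Cutoff

section CutoffLimit

variable {V : Type*} [NormedAddCommGroup V] [NormedSpace ℝ V] [MeasurableSpace V] [BorelSpace V]
  {μ : Measure V} {η g : V → ℝ}

lemma integrable_comp_const_smul_mul (hη : Continuous η) (hsupp : HasCompactSupport η)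
    (hg : Integrable g μ) (ρ : ℝ) : Integrable (fun x => η (ρ • x) * g x) μ := by
  obtain ⟨C, hC⟩ := hsupp.exists_bound_of_continuous hη
  exact hg.bdd_mul (hη.comp (continuous_const_smul ρ)).aestronglyMeasurable
    (ae_of_all _ fun x => hC (ρ • x))

lemma tendsto_integral_comp_const_smul_mul (hη : Continuous η) (hsupp : HasCompactSupport η)
    (hg : Integrable g μ) :
    Tendsto (fun ρ : ℝ => ∫ x, η (ρ • x) * g x ∂μ) (𝓝 0) (𝓝 (η 0 * ∫ x, g x ∂μ)) := by
  obtain ⟨C, hC⟩ := hsupp.exists_bound_of_continuous hη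
  rw [← integral_const_mul]
  refine tendsto_integral_filter_of_dominated_convergence (fun x => C * ‖g x‖)
    (Eventually.of_forall fun ρ => (integrable_comp_const_smul_mul hη hsupp hg ρ).1)
    (Eventually.of_forall fun ρ => ae_of_all _ fun x => ?_) (hg.norm.const_mul C)
    (ae_of_all _ fun x => ?_)
  · rw [norm_mul]
    gcongr
    exact hC (ρ • x)
  · have : Continuous fun ρ : ℝ => η (ρ • x) * g x := by fun_prop
    simpa using this.tendsto 0

lemma lintegral_le_liminf_lintegral_comp_const_smul_mul (hη : Continuous η) (hg : Measurable g) :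
    ∫⁻ x, ENNReal.ofReal (η 0 * g x) ∂μ
      ≤ liminf (fun ρ : ℝ => ∫⁻ x, ENNReal.ofReal (η (ρ • x) * g x) ∂μ) (𝓝[≠] 0) := by
  have hliminf (x : V) : liminf (fun ρ : ℝ => ENNReal.ofReal (η (ρ • x) * g x)) (𝓝[≠] 0)
      = ENNReal.ofReal (η 0 * g x) := by
    have hcont : Continuous fun ρ : ℝ => ENNReal.ofReal (η (ρ • x) * g x) :=
      ENNReal.continuous_ofReal.comp (by fun_prop)
    simpa using ((hcont.tendsto 0).mono_left nhdsWithin_le_nhds).liminf_eq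
  simp only [← hliminf]
  exact lintegral_liminf_le fun ρ =>
    ((hη.comp (continuous_const_smul ρ)).measurable.mul hg).ennreal_ofReal

end CutoffLimit

lemma tendsto_integral_mul_driftLaplacian_comp_const_smul {V : Type*} [NormedAddCommGroup V]
    [InnerProductSpace ℝ V] [FiniteDimensional ℝ V] [MeasurableSpace V] [BorelSpace V]
    {μ : Measure V} {φ g : V → ℝ} (hφ : ContDiff ℝ 2 φ) (hsupp : HasCompactSupport φ)
    (hg : Integrable g μ) :
    Tendsto (fun ρ : ℝ => ∫ x, φ (ρ • x) * driftLaplacian (fun y => φ (ρ • y)) x * g x ∂μ)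
      (𝓝 0) (𝓝 0) := by
  let A : V → ℝ := fun x => φ x * Δ φ x
  let B : V → ℝ := fun x => φ x * fderiv ℝ φ x ((1 / 2 : ℝ) • x)
  have hA : Continuous A := hφ.continuous.mul (continuous_laplacian hφ)
  have hB : Continuous B :=
    hφ.continuous.mul (continuous_fderiv_apply_half (hφ.of_le one_le_two))
  have hAs : HasCompactSupport A := hsupp.mul_right
  have hBs : HasCompactSupport B := hsupp.mul_right
  have hB0 : B 0 = 0 := by simp [B]
  have hsplit (ρ : ℝ) : ∫ x, φ (ρ • x) * driftLaplacian (fun y => φ (ρ • y)) x * g x ∂μ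
      = ρ ^ 2 * ∫ x, A (ρ • x) * g x ∂μ - ∫ x, B (ρ • x) * g x ∂μ := by
    rw [← integral_const_mul, ← integral_sub
      ((integrable_comp_const_smul_mul hA hAs hg ρ).const_mul _)
      (integrable_comp_const_smul_mul hB hBs hg ρ)]
    refine integral_congr_ae (ae_of_all _ fun x => ?_)
    simp only [A, B, driftLaplacian_comp_const_smul hφ]
    ring
  simpa [hsplit, hB0] using (((continuous_pow 2).tendsto (0 : ℝ)).mul
    (tendsto_integral_comp_const_smul_mul hA hAs hg)).sub
    (tendsto_integral_comp_const_smul_mul hB hBs hg)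

variable {m n : ℕ} {f : E m → E (n + 1)}

section Gaussian

lemma gaussian_pos (x₀ : E m) {t₀ : ℝ} (ht₀ : 0 < t₀) (x : E m) : 0 < gaussian x₀ t₀ x := by
  unfold gaussian
  positivity

lemma continuous_gaussian (x₀ : E m) (t₀ : ℝ) : Continuous (gaussian x₀ t₀) := by
  unfold gaussian
  fun_prop

lemma integrable_gaussian (x₀ : E m) {t₀ : ℝ} (ht₀ : 0 < t₀) : Integrable (gaussian x₀ t₀) := by
  have hexp : Integrable fun x : E m => Real.exp (-(1 / (4 * t₀)) * ‖x‖ ^ 2) := by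
    have h := (GaussianFourier.integrable_cexp_neg_mul_sq_norm_add (V := E m)
      (b := ((1 / (4 * t₀) : ℝ) : ℂ)) (by rw [Complex.ofReal_re]; positivity) 0 0).norm
    refine h.congr (ae_of_all _ fun x => ?_)
    simp only [Complex.norm_exp, zero_mul, add_zero]
    norm_cast
  have hgaussian : gaussian x₀ t₀ = fun x =>
      Real.exp (-(1 / (4 * t₀)) * ‖x - x₀‖ ^ 2) / (4 * Real.pi * t₀) ^ ((m : ℝ) / 2) := by
    ext x
    rw [gaussian]
    congr 2
    ring
  rw [hgaussian]
  exact (hexp.comp_sub_right x₀).div_const _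

end Gaussian

section SphereMap

lemma IsSphereMap.norm_eq_one (hf : IsSphereMap f) (x : E m) : ‖f x‖ = 1 :=
  mem_sphere_zero_iff_norm.1 (hf.2 x)

lemma IsSphereMap.differentiable (hf : IsSphereMap f) : Differentiable ℝ f :=
  hf.1.differentiable (by simp)

lemma contDiff_fderiv_apply_const {g : E m → E (n + 1)} (hg : ContDiff ℝ ∞ g) (v : E m) :
    ContDiff ℝ ∞ fun x => fderiv ℝ g x v :=
  (hg.fderiv_right (by simp)).clm_apply contDiff_const

lemma IsSphereMap.inner_fderiv_self (hf : IsSphereMap f) (x v : E m) :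
    ⟪f x, fderiv ℝ f x v⟫ = 0 := by
  have h : fderiv ℝ (fun y => ⟪f y, f y⟫) x v = 0 := by
    simp only [real_inner_self_eq_norm_sq, hf.norm_eq_one, fderiv_fun_const, Pi.zero_apply,
      zero_apply]
  rw [fderiv_inner_apply ℝ (hf.differentiable x) (hf.differentiable x),
    real_inner_comm (f x) (fderiv ℝ f x v)] at h
  linarith

lemma IsSphereMap.inner_fderiv_fderiv (hf : IsSphereMap f) (x v : E m) :
    ⟪f x, fderiv ℝ (fun y => fderiv ℝ f y v) x v⟫ = -‖fderiv ℝ f x v‖ ^ 2 := by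
  have h : fderiv ℝ (fun y => ⟪f y, fderiv ℝ f y v⟫) x v = 0 := by
    simp only [hf.inner_fderiv_self, fderiv_fun_const, Pi.zero_apply, zero_apply]
  rw [fderiv_inner_apply ℝ (hf.differentiable x)
    ((contDiff_fderiv_apply_const hf.1 v).differentiable (by simp) x),
    real_inner_self_eq_norm_sq] at h
  linarith

lemma IsSphereMap.inner_tension_of_inner_fderiv_eq_zero (hf : IsSphereMap f) {w : E (n + 1)}
    (hw : ∀ x v, ⟪w, fderiv ℝ f x v⟫ = 0) (x : E m) :
    ⟪w, tension f x⟫ = energySq f x * ⟪w, f x⟫ := by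
  rw [tension, energySq, inner_sum, Finset.sum_mul]
  refine Finset.sum_congr rfl fun i _ => ?_
  have h : ⟪w, fderiv ℝ (fun y => fderiv ℝ f y (basisVec i)) x (basisVec i)⟫ = 0 :=
    inner_fderiv_eq_zero_of_inner_eq_zero
      ((contDiff_fderiv_apply_const hf.1 _).differentiable (by simp)) (fun y => hw y _) x _
  rw [covDeriv, tangentProj, inner_sub_right, inner_smul_right, h, real_inner_comm (f x),
    hf.inner_fderiv_fderiv]
  ring

lemma IsSphereMap.inner_conformalField_fderiv (hf : IsSphereMap f) (w : E (n + 1)) (x v : E m) :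
    ⟪conformalField w (f x), fderiv ℝ f x v⟫ = ⟪w, fderiv ℝ f x v⟫ := by
  rw [conformalField, inner_sub_left, inner_smul_left, hf.inner_fderiv_self, mul_zero, sub_zero]

lemma IsSphereMap.exists_conformalField_normal_of_mem_submodule (hf : IsSphereMap f)
    {S : Submodule ℝ (E (n + 1))} (hS : S ≠ ⊤) (hfS : ∀ x, f x ∈ S) :
    ∃ w : E (n + 1), w ≠ 0 ∧ ∀ x v, ⟪conformalField w (f x), fderiv ℝ f x v⟫ = 0 := by
  obtain ⟨w, hwS, hw0⟩ := Submodule.exists_mem_ne_zero_of_ne_bot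
    (mt Submodule.orthogonal_eq_bot_iff.1 hS)
  refine ⟨w, hw0, fun x v => ?_⟩
  rw [hf.inner_conformalField_fderiv]
  exact inner_fderiv_eq_zero_of_inner_eq_zero hf.differentiable
    (fun y => Submodule.inner_left_of_mem_orthogonal (hfS y) hwS) x v

end SphereMap

section Energy

lemma energySq_nonneg (f : E m → E (n + 1)) (x : E m) : 0 ≤ energySq f x :=
  Finset.sum_nonneg fun _ _ => sq_nonneg _

lemma continuous_energySq (hf : ContDiff ℝ 1 f) : Continuous (energySq f) := by
  have := hf.continuous_fderiv one_ne_zero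
  unfold energySq
  fun_prop

lemma fderiv_eq_zero_of_energySq_eq_zero {x : E m} (h : energySq f x = 0) :
    fderiv ℝ f x = 0 := by
  have hnorm := (Finset.sum_eq_zero_iff_of_nonneg fun i _ => sq_nonneg _).1 h
  refine ContinuousLinearMap.coe_injective
    ((EuclideanSpace.basisFun (Fin m) ℝ).toBasis.ext fun i => ?_)
  simpa [basisVec] using hnorm i (Finset.mem_univ i)

lemma exists_eq_const_of_energySq_eq_zero (hf : Differentiable ℝ f)
    (h : ∀ x, energySq f x = 0) : ∃ p, ∀ x, f x = p :=
  ⟨f 0, fun x => is_const_of_fderiv_eq_zero hf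
    (fun y => fderiv_eq_zero_of_energySq_eq_zero (h y)) x 0⟩

lemma exists_eq_const_of_calF_eq_zero (hf : ContDiff ℝ 1 f) {x₀ : E m} {t₀ : ℝ} (ht₀ : 0 < t₀)
    (h : calF x₀ t₀ f = 0) : ∃ p, ∀ x, f x = p := by
  refine exists_eq_const_of_energySq_eq_zero (hf.differentiable one_ne_zero) fun x => ?_
  have hcont : Continuous fun x => ENNReal.ofReal (energySq f x * gaussian x₀ t₀ x) :=
    ENNReal.continuous_ofReal.comp ((continuous_energySq hf).mul (continuous_gaussian x₀ t₀))
  have hint : ∫⁻ x, ENNReal.ofReal (energySq f x * gaussian x₀ t₀ x) = 0 :=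
    (mul_eq_zero.1 h).resolve_left (ENNReal.ofReal_pos.2 (half_pos ht₀)).ne'
  have hzero := (hcont.ae_eq_iff_eq volume continuous_zero).1
    ((lintegral_eq_zero_iff hcont.measurable).1 hint)
  exact le_antisymm (nonpos_of_mul_nonpos_left (ENNReal.ofReal_eq_zero.1 (congrFun hzero x))
    (gaussian_pos x₀ ht₀ x)) (energySq_nonneg f x)

lemma calF_le_entropy (f : E m → E (n + 1)) (x₀ : E m) {t₀ : ℝ} (ht₀ : 0 < t₀) :
    calF x₀ t₀ f ≤ entropy f :=
  le_iSup_of_le x₀ (le_iSup_of_le t₀ (le_iSup_of_le ht₀ le_rfl))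

lemma exists_eq_const_of_entropy_eq_zero (hf : ContDiff ℝ 1 f) (h : entropy f = 0) :
    ∃ p, ∀ x, f x = p :=
  exists_eq_const_of_calF_eq_zero hf one_pos
    (le_antisymm ((calF_le_entropy f 0 one_pos).trans_eq h) zero_le)

end Energy

lemma IsSoliton.exists_eq_const_or_inner_eq_zero (hf : IsSoliton f) {w : E (n + 1)}
    (hw : ∀ x v, ⟪conformalField w (f x), fderiv ℝ f x v⟫ = 0) :
    (∃ p, ∀ x, f x = p) ∨ ∀ x, ⟪w, f x⟫ = 0 := by
  have hnormal : ∀ x v, ⟪w, fderiv ℝ f x v⟫ = 0 := fun x v => by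
    rw [← hf.1.inner_conformalField_fderiv, hw]
  have hconst : ∀ x, ⟪w, f x⟫ = ⟪w, f 0⟫ := fun x =>
    inner_eq_inner_of_inner_fderiv_eq_zero hf.1.differentiable hnormal x 0
  have henergy : ∀ x, energySq f x * ⟪w, f 0⟫ = 0 := fun x => by
    rw [← hconst x, ← hf.1.inner_tension_of_inner_fderiv_eq_zero hnormal, hf.2, hnormal]
  rcases eq_or_ne ⟪w, f 0⟫ 0 with h0 | h0
  · exact Or.inr fun x => (hconst x).trans h0
  · exact Or.inl (exists_eq_const_of_energySq_eq_zero hf.1.differentiable fun x =>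
      (mul_eq_zero.1 (henergy x)).resolve_right h0)

section EntropyStability

lemma IsSphereMap.smul_add_const (hf : IsSphereMap f) {c : ℝ} {v : E (n + 1)}
    (hv : ∀ x, ⟪v, f x⟫ = 0) (hcv : c ^ 2 + ‖v‖ ^ 2 = 1) : IsSphereMap fun x => c • f x + v := by
  refine ⟨(hf.1.const_smul c).add contDiff_const, fun x => ?_⟩
  rw [mem_sphere_zero_iff_norm, ← sq_eq_sq₀ (norm_nonneg _) zero_le_one, norm_add_sq_real,
    inner_smul_left, real_inner_comm, hv, norm_smul, hf.norm_eq_one, Real.norm_eq_abs, mul_one,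
    sq_abs, mul_zero, mul_zero, add_zero, hcv, one_pow]

lemma energySq_smul_add_const (f : E m → E (n + 1)) (c : ℝ) (v : E (n + 1)) (x : E m) :
    energySq (fun y => c • f y + v) x = c ^ 2 * energySq f x := by
  have h : fderiv ℝ (fun y => c • f y + v) x = c • fderiv ℝ f x := by
    rw [fderiv_add_const]
    exact congrFun (fderiv_const_smul_field c) x
  simp only [energySq, h, smul_apply, norm_smul, mul_pow, Real.norm_eq_abs, sq_abs,
    Finset.mul_sum]

lemma entropy_smul_add_const (f : E m → E (n + 1)) (c : ℝ) (v : E (n + 1)) :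
    entropy (fun x => c • f x + v) = ENNReal.ofReal (c ^ 2) * entropy f := by
  have hcalF (x₀ : E m) (t₀ : ℝ) :
      calF x₀ t₀ (fun x => c • f x + v) = ENNReal.ofReal (c ^ 2) * calF x₀ t₀ f := by
    simp only [calF, energySq_smul_add_const, mul_assoc, ENNReal.ofReal_mul (sq_nonneg c)]
    rw [lintegral_const_mul' _ _ ENNReal.ofReal_ne_top, mul_left_comm]
  simp only [entropy, hcalF, ENNReal.mul_iSup]

lemma isClose_smul_add_const {k : ℕ} (hf : ContDiff ℝ k f) {ε c : ℝ} {v : E (n + 1)}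
    (hc : |c - 1| ≤ ε) (hv : ‖v‖ ≤ ε) : IsClose k ε f fun x => c • f x + v := by
  intro j hj x
  have hfj : ContDiffAt ℝ j f x := (hf.of_le (by exact_mod_cast hj)).contDiffAt
  have hderiv : iteratedFDeriv ℝ j (fun y => c • f y + v) x
      = c • iteratedFDeriv ℝ j f x + iteratedFDeriv ℝ j (fun _ : E m => v) x := by
    rw [← iteratedFDeriv_const_smul_apply hfj]
    exact iteratedFDeriv_add_apply (hfj.const_smul c) contDiffAt_const
  have hconst : ‖iteratedFDeriv ℝ j (fun _ : E m => v) x‖ ≤ ε := by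
    rcases eq_or_ne j 0 with rfl | hj0
    · rwa [norm_iteratedFDeriv_zero]
    · rw [iteratedFDeriv_const_of_ne hj0, Pi.zero_apply, norm_zero]
      exact (norm_nonneg v).trans hv
  calc ‖iteratedFDeriv ℝ j (fun y => c • f y + v) x - iteratedFDeriv ℝ j f x‖
      = ‖(c - 1) • iteratedFDeriv ℝ j f x + iteratedFDeriv ℝ j (fun _ : E m => v) x‖ := by
        rw [hderiv, sub_smul, one_smul, add_sub_right_comm]
    _ ≤ |c - 1| * ‖iteratedFDeriv ℝ j f x‖ + ‖iteratedFDeriv ℝ j (fun _ : E m => v) x‖ := by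
        rw [← Real.norm_eq_abs, ← norm_smul]
        exact norm_add_le _ _
    _ ≤ ε * ‖iteratedFDeriv ℝ j f x‖ + ε := by gcongr
    _ = ε * (1 + ‖iteratedFDeriv ℝ j f x‖) := by ring

lemma IsEntropyStable.exists_eq_const_of_inner_eq_zero (hf : IsEntropyStable f)
    (hfin : entropy f < ⊤) {u : E (n + 1)} (hu : ‖u‖ = 1) (huf : ∀ x, ⟪u, f x⟫ = 0) :
    ∃ p, ∀ x, f x = p := by
  obtain ⟨⟨hsphere, -⟩, k, ε, hε, hmin⟩ := hf
  obtain ⟨s, hs0, hs1, hsε⟩ : ∃ s : ℝ, 0 < s ∧ s ≤ 1 ∧ s ≤ ε :=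
    ⟨min 1 ε, lt_min one_pos hε, min_le_left _ _, min_le_right _ _⟩
  have hnorm : ‖Real.sin s • u‖ = |Real.sin s| := by rw [norm_smul, hu, mul_one, Real.norm_eq_abs]
  have hle : entropy f ≤ ENNReal.ofReal (Real.cos s ^ 2) * entropy f := by
    rw [← entropy_smul_add_const f _ (Real.sin s • u)]
    refine hmin _ (hsphere.smul_add_const (fun x => ?_) ?_)
      (isClose_smul_add_const (hsphere.1.of_le (by exact_mod_cast le_top)) ?_ ?_)
    · rw [inner_smul_left, huf, mul_zero]
    · rw [hnorm, sq_abs, Real.cos_sq_add_sin_sq]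
    · rw [abs_sub_comm, abs_of_nonneg (sub_nonneg.2 (Real.cos_le_one s))]
      nlinarith [Real.one_sub_sq_div_two_le_cos (x := s)]
    · rw [hnorm]
      exact Real.abs_sin_le_abs.trans ((abs_of_pos hs0).trans_le hsε)
  have hcos : ENNReal.ofReal (Real.cos s ^ 2) < 1 := by
    rw [ENNReal.ofReal_lt_one]
    nlinarith [Real.cos_sq_add_sin_sq s, pow_pos (Real.sin_pos_of_pos_of_le_one hs0 hs1) 2]
  refine exists_eq_const_of_entropy_eq_zero (hsphere.1.of_le (by simp)) ?_
  by_contra h0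
  exact hle.not_gt (by simpa using ENNReal.mul_lt_mul_left h0 hfin.ne hcos)

end EntropyStability

section CompactlySupportedSections

variable {X : E m → E (n + 1)}

lemma contDiff_covDeriv (hf : ContDiff ℝ ∞ f) (hX : ContDiff ℝ ∞ X) (v : E m) :
    ContDiff ℝ ∞ (covDeriv f X v) := by
  have hDX := contDiff_fderiv_apply_const hX v
  exact hDX.sub ((hDX.inner ℝ hf).smul hf)

lemma covDeriv_eq_zero_of_notMem_tsupport {x : E m} (hx : x ∉ tsupport X) (v : E m) :
    covDeriv f X v x = 0 := by
  rw [covDeriv, fderiv_of_notMem_tsupport ℝ hx, tangentProj]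
  simp

lemma tsupport_covDeriv_subset (f X : E m → E (n + 1)) (v : E m) :
    tsupport (covDeriv f X v) ⊆ tsupport X :=
  closure_minimal (fun _ hx => by_contra fun h => hx (covDeriv_eq_zero_of_notMem_tsupport h v))
    (isClosed_tsupport X)

lemma continuous_opL (hf : ContDiff ℝ ∞ f) (hX : ContDiff ℝ ∞ X) : Continuous (opL f X) := by
  have hcov (v : E m) := contDiff_covDeriv hf hX v
  have hcov₂ (v : E m) : Continuous (covDeriv f (covDeriv f X v) v) :=
    (contDiff_covDeriv hf (hcov v) v).continuous
  have hDf := hf.continuous_fderiv (by simp)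
  have hDX := hX.continuous_fderiv (by simp)
  have hf₀ := hf.continuous
  have hX₀ := hX.continuous
  unfold opL sphereCurv
  refine (Continuous.sub (continuous_finsetSum _ fun i _ => hcov₂ (basisVec i)).neg ?_).add ?_
  · fun_prop
  · unfold covDeriv tangentProj
    fun_prop

lemma opL_eq_zero_of_notMem_tsupport {x : E m} (hx : x ∉ tsupport X) : opL f X x = 0 := by
  have hcov₂ (v : E m) : covDeriv f (covDeriv f X v) v x = 0 :=
    covDeriv_eq_zero_of_notMem_tsupport (mt (tsupport_covDeriv_subset f X v ·) hx) v
  simp [opL, sphereCurv, hcov₂, covDeriv_eq_zero_of_notMem_tsupport hx,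
    image_eq_zero_of_notMem_tsupport hx]

lemma IsSection.memW22_of_hasCompactSupport (hf : ContDiff ℝ ∞ f) (hX : IsSection f X)
    (hsupp : HasCompactSupport X) : MemW22 f X := by
  refine ⟨hX, (Continuous.integrable_of_hasCompactSupport ?_
    (HasCompactSupport.intro hsupp fun x hx => ?_)).lintegral_lt_top⟩
  · have hcov (v : E m) := (contDiff_covDeriv hf hX.1 v).continuous
    have hL := continuous_opL hf hX.1
    have hX₀ := hX.1.continuous
    have hG := continuous_gaussian (0 : E m) 1
    fun_prop
  · simp [opL_eq_zero_of_notMem_tsupport hx, covDeriv_eq_zero_of_notMem_tsupport hx,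
      image_eq_zero_of_notMem_tsupport hx]

end CompactlySupportedSections

section SecondVariation

variable {φ : E m → ℝ} {u : E (n + 1)}

lemma laplacian_eq_sum_fderiv_fderiv (hφ : ContDiff ℝ 2 φ) (x : E m) :
    Δ φ x = ∑ i, fderiv ℝ (fun y => fderiv ℝ φ y (basisVec i)) x (basisVec i) := by
  have hDφ : DifferentiableAt ℝ (fderiv ℝ φ) x :=
    (hφ.fderiv_right (m := 1) (by norm_num)).differentiable one_ne_zero x
  rw [InnerProductSpace.laplacian_eq_iteratedFDeriv_orthonormalBasis φ
    (EuclideanSpace.basisFun (Fin m) ℝ)]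
  refine Finset.sum_congr rfl fun i _ => ?_
  rw [iteratedFDeriv_two_apply, fderiv_clm_apply hDφ (differentiableAt_const _)]
  simp [basisVec]

lemma covDeriv_smul_const {x : E m} (hφ : DifferentiableAt ℝ φ x) (hux : ⟪u, f x⟫ = 0)
    (v : E m) : covDeriv f (fun y => φ y • u) v x = fderiv ℝ φ x v • u := by
  rw [covDeriv, fderiv_smul_const hφ, tangentProj]
  simp [inner_smul_left, hux]

lemma opL_smul_const (hf : Differentiable ℝ f) (huf : ∀ x, ⟪u, f x⟫ = 0) (hφ : ContDiff ℝ 2 φ)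
    (x : E m) :
    opL f (fun y => φ y • u) x = -(driftLaplacian φ x + φ x * energySq f x) • u := by
  have hcov (v y : E m) : covDeriv f (fun y => φ y • u) v y = fderiv ℝ φ y v • u :=
    covDeriv_smul_const (hφ.differentiable two_ne_zero y) (huf y) v
  have hcov₂ (v : E m) : covDeriv f (fun y => fderiv ℝ φ y v • u) v x
      = fderiv ℝ (fun y => fderiv ℝ φ y v) x v • u :=
    covDeriv_smul_const (((hφ.fderiv_right (m := 1) (by norm_num)).clm_apply
      contDiff_const).differentiable one_ne_zero x) (huf x) v
  have hcurv (v : E m) : sphereCurv (φ x • u) (fderiv ℝ f x v) (fderiv ℝ f x v)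
      = (φ x * ‖fderiv ℝ f x v‖ ^ 2) • u := by
    rw [sphereCurv, inner_smul_left, inner_fderiv_eq_zero_of_inner_eq_zero hf huf,
      real_inner_self_eq_norm_sq, mul_zero, zero_smul, sub_zero, smul_smul, mul_comm]
  simp only [opL, hcov, hcov₂, hcurv, ← Finset.sum_smul, ← Finset.mul_sum, driftLaplacian,
    laplacian_eq_sum_fderiv_fderiv hφ, energySq]
  module

lemma IsSphereMap.secondVar_smul_const_le (hf : IsSphereMap f) (hu : ‖u‖ = 1)
    (huf : ∀ x, ⟪u, f x⟫ = 0) (hφ : ContDiff ℝ 2 φ) (q : ℝ) (V : E m) :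
    secondVar f q V (fun y => φ y • u)
      ≤ ∫ x, -(φ x * (driftLaplacian φ x + φ x * energySq f x) * gaussian 0 1 x) := by
  have hnormal := inner_fderiv_eq_zero_of_inner_eq_zero hf.differentiable huf
  have htension (x : E m) : ⟪u, tension f x⟫ = 0 := by
    rw [hf.inner_tension_of_inner_fderiv_eq_zero hnormal, huf, mul_zero]
  have hnonneg : 0 ≤ ∫ x, (q ^ 2 * ‖tension f x‖ ^ 2 + 1 / 2 * ‖fderiv ℝ f x V‖ ^ 2)
      * gaussian 0 1 x :=
    integral_nonneg fun x => mul_nonneg (by positivity) (gaussian_pos 0 one_pos x).le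
  refine (sub_le_self _ hnonneg).trans_eq (integral_congr_ae (ae_of_all _ fun x => ?_))
  simp only [opL_smul_const hf.differentiable huf hφ, inner_sub_right, inner_smul_left,
    inner_smul_right, hnormal, htension, real_inner_self_eq_norm_sq, hu, conj_trivial]
  ring

lemma IsFStable.lintegral_sq_mul_energySq_le (hf : IsFStable f) (hu : ‖u‖ = 1)
    (huf : ∀ x, ⟪u, f x⟫ = 0) (hφ : ContDiff ℝ ∞ φ) (hsupp : HasCompactSupport φ) :
    ∫⁻ x, ENNReal.ofReal (φ x ^ 2 * (energySq f x * gaussian 0 1 x))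
      ≤ ENNReal.ofReal (-∫ x, φ x * driftLaplacian φ x * gaussian 0 1 x) := by
  have hsphere := hf.1.1
  have hφ₂ : ContDiff ℝ 2 φ := contDiff_infty.1 hφ 2
  have hφ₀ := hφ.continuous
  have he := continuous_energySq (hsphere.1.of_le (by simp))
  have hG := continuous_gaussian (0 : E m) 1
  have hL := continuous_driftLaplacian hφ₂
  have hdrift : Integrable fun x => φ x * driftLaplacian φ x * gaussian 0 1 x :=
    (by fun_prop : Continuous _).integrable_of_hasCompactSupport hsupp.mul_right.mul_right
  have hdrift_neg : Integrable fun x => -(φ x * driftLaplacian φ x * gaussian 0 1 x) :=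
    hdrift.neg
  have hmass : Integrable fun x => φ x ^ 2 * (energySq f x * gaussian 0 1 x) :=
    (by fun_prop : Continuous _).integrable_of_hasCompactSupport
      (HasCompactSupport.intro hsupp fun x hx => by simp [image_eq_zero_of_notMem_tsupport hx])
  have hX : IsSection f fun x => φ x • u :=
    ⟨hφ.smul contDiff_const, fun x => by rw [inner_smul_left, huf, mul_zero]⟩
  obtain ⟨q, V, hqV⟩ := hf.2 _ (hX.memW22_of_hasCompactSupport hsphere.1 hsupp.smul_right)
  have hsum : ∫ x, -(φ x * (driftLaplacian φ x + φ x * energySq f x) * gaussian 0 1 x)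
      = -(∫ x, φ x * driftLaplacian φ x * gaussian 0 1 x)
        - ∫ x, φ x ^ 2 * (energySq f x * gaussian 0 1 x) := by
    rw [← integral_neg, ← integral_sub hdrift_neg hmass]
    exact integral_congr_ae (ae_of_all _ fun x => by ring)
  rw [← ofReal_integral_eq_lintegral_ofReal hmass (ae_of_all _ fun x => mul_nonneg (sq_nonneg _)
    (mul_nonneg (energySq_nonneg f x) (gaussian_pos 0 one_pos x).le))]
  refine ENNReal.ofReal_le_ofReal (sub_nonneg.1 ?_)
  rw [← hsum]
  exact hqV.trans (hsphere.secondVar_smul_const_le hu huf hφ₂ q V)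

lemma IsFStable.exists_eq_const_of_inner_eq_zero (hf : IsFStable f) (hu : ‖u‖ = 1)
    (huf : ∀ x, ⟪u, f x⟫ = 0) : ∃ p, ∀ x, f x = p := by
  have hsmooth : ContDiff ℝ 1 f := hf.1.1.1.of_le (by simp)
  let φ : ContDiffBump (0 : E m) := default
  have hφ : ContDiff ℝ ∞ φ := φ.contDiff
  have hφ0 : φ 0 = 1 := φ.one_of_mem_closedBall (Metric.mem_closedBall_self φ.rIn_pos.le)
  have hstable : ∀ᶠ ρ in 𝓝[≠] (0 : ℝ),
      ∫⁻ x, ENNReal.ofReal (φ (ρ • x) ^ 2 * (energySq f x * gaussian 0 1 x)) ≤ ENNReal.ofReal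
      (-∫ x, φ (ρ • x) * driftLaplacian (fun y => φ (ρ • y)) x * gaussian 0 1 x) := by
    filter_upwards [self_mem_nhdsWithin] with ρ hρ
    exact hf.lintegral_sq_mul_energySq_le hu huf (hφ.comp (contDiff_id.const_smul ρ))
      (φ.hasCompactSupport.comp_smul hρ)
  have hlim : Tendsto (fun ρ : ℝ => ENNReal.ofReal
      (-∫ x, φ (ρ • x) * driftLaplacian (fun y => φ (ρ • y)) x * gaussian 0 1 x))
      (𝓝[≠] 0) (𝓝 0) := by
    simpa using ENNReal.tendsto_ofReal (tendsto_integral_mul_driftLaplacian_comp_const_smul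
      (contDiff_infty.1 hφ 2) φ.hasCompactSupport
      (integrable_gaussian (0 : E m) one_pos)).neg |>.mono_left nhdsWithin_le_nhds
  have hfatou := lintegral_le_liminf_lintegral_comp_const_smul_mul (μ := volume)
    (φ.continuous.pow 2) ((continuous_energySq hsmooth).mul (continuous_gaussian 0 1)).measurable
  have hzero : ∫⁻ x, ENNReal.ofReal (energySq f x * gaussian 0 1 x) = 0 := by
    refine le_antisymm ?_ zero_le
    simpa [hφ0] using hfatou.trans ((liminf_le_liminf hstable).trans_eq hlim.liminf_eq)
  exact exists_eq_const_of_calF_eq_zero hsmooth one_pos (by rw [calF, hzero, mul_zero])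

end SecondVariation

end HarmonicSoliton

open HarmonicSoliton in
theorem mainTheorem5_general {m n : ℕ} {f : E m → E (n + 1)} (hf : IsSoliton f)
    (hw : ∃ w : E (n + 1), w ≠ 0 ∧ ∀ x v, ⟪conformalField w (f x), fderiv ℝ f x v⟫ = 0) :
    (∃ p, ∀ x, f x = p) ∨ ((entropy f < ⊤ → ¬ IsEntropyStable f) ∧ ¬ IsFStable f) := by
  obtain ⟨w, hw0, hw⟩ := hw
  refine or_iff_not_imp_left.2 fun hne => ?_
  have hwf := (hf.exists_eq_const_or_inner_eq_zero hw).resolve_left hne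
  have hu : ‖‖w‖⁻¹ • w‖ = 1 := norm_smul_inv_norm (𝕜 := ℝ) hw0
  have huf (x : E m) : ⟪‖w‖⁻¹ • w, f x⟫ = 0 := by rw [inner_smul_left, hwf, mul_zero]
  exact ⟨fun hfin h => hne (h.exists_eq_const_of_inner_eq_zero hfin hu huf),
    fun h => hne (h.exists_eq_const_of_inner_eq_zero hu huf)⟩

theorem mainTheorem5 (m n : ℕ) (f : HarmonicSoliton.E m → HarmonicSoliton.E (n + 1))
    (hf : HarmonicSoliton.IsSoliton f) (hfin : HarmonicSoliton.entropy f < ⊤) :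
    ((∃ w : HarmonicSoliton.E (n + 1), w ≠ 0 ∧
        ∀ x v, inner ℝ (HarmonicSoliton.conformalField w (f x)) (fderiv ℝ f x v) = 0) →
      (∃ p, ∀ x, f x = p) ∨
        (¬ HarmonicSoliton.IsEntropyStable f ∧ ¬ HarmonicSoliton.IsFStable f)) ∧
    ((∃ S : Submodule ℝ (HarmonicSoliton.E (n + 1)), S ≠ ⊤ ∧ ∀ x, f x ∈ S) →
      (∃ p, ∀ x, f x = p) ∨
        (¬ HarmonicSoliton.IsEntropyStable f ∧ ¬ HarmonicSoliton.IsFStable f)) := by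
  have h hw := (mainTheorem5_general hf hw).imp_right (And.imp_left fun h => h hfin)
  exact ⟨h, fun ⟨_, hS, hfS⟩ => h (hf.1.exists_conformalField_normal_of_mem_submodule hS hfS)⟩
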